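/- Let $n\ge 1$, let $\gamma_0<\dots<\gamma_{n-1}$ be real numbers, write $[m]=\{0,\dots,m-1\}$, and let $\mathcal P$ be the law of an observed triple $(Y,D,Z)$ with $Y\in\{\gamma_0,\dots,\gamma_{n-1}\}$ almost surely, treatment $D\in\{0,1\}$, and binary instrument $Z\in\{0,1\}$ with $\mathcal P(Z=z)>0$ for $z=0,1$. Put $p_{yd,z}=\mathcal P(Y=\gamma_y,\,D=d\mid Z=z)$. A full data distribution (a joint distribution of potential outcomes $Y^{(d,z)}\in\{\gamma_0,\dots,\gamma_{n-1}\}$, potential treatments $D^{(z)}\in\{0,1\}$, the instrument $Z$, and the observed variables $Y,D$) follows the IV model if (a) (exclusion) $Y^{(d,z)}=Y^{(d,z')}$ almost surely for all $d,z,z'$, the common variable being denoted $Y^{(d)}$; (b) (random assignment) $Z$ is independent of $(Y^{(0)},Y^{(1)},D^{(0)},D^{(1)})$; and (c) (consistency) $Y=(1-D)Y^{(0)}+DY^{(1)}$ and $D=\sum_{z}\mathbf 1(Z=z)D^{(z)}$ almost surely. Consider the linear inequalities $$ \begin{aligned} &\sum_{k\in[n]}-p_{k0,1}+\sum_{k\in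 T}(p_{k1,0}-p_{k1,1})\le 0 &&\text{for all } \varnothing\ne T\subseteq[n-1],\\ &\sum_{k\in[n]}-p_{k1,0}+\sum_{k\in T}(p_{k0,1}-p_{k0,0})\le 0 &&\text{for all } \varnothing\ne T\subsetneq[n],\\ &\sum_{k\in[n]}-p_{k0,0}+\sum_{k\in T}(p_{k1,1}-p_{k1,0})\le 0 &&\text{for all } \varnothing\ne T\subseteq[n-1]. \end{aligned} $$ Theorem. (i) For every observed law $\mathcal P$ as above, there is a full data distribution that follows the IV model and induces $\mathcal P$ as the law of $(Y,D,Z)$ if and only if all of these inequalities hold. (ii) None of them is redundant: for each of the inequalities there is an observed law $\mathcal P$ as above that violates it and satisfies all the others. (iii) The inequalities are pairwise distinct as linear inequalities in the variables $(p_{yd,z})$, and their number is exactly $2^{n+1}-4$. -/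

import Mathlib

open MeasureTheory ProbabilityTheory

universe u

/-- The discrete instrumental variable model with outcome support `{γ 0, …, γ (n-1)}`, dichotomous
treatment and instrument with values in `{0, …, ℓ-1}`, on a probability space `(Ω, μ)`:
`Ypot d z` is the potential outcome `Y^(d,z)`, `Dpot z` is the potential treatment `D^(z)`, and
`(Y, D, Z)` are the observed outcome, treatment and instrument. By exclusion, `Y^(d)` is any of the
almost surely equal variables `Y^(d,z)`; the conditions on `Y^(0)`, `Y^(1)` are stated for each of
these versions. -/
structure IsIVModel {n ℓ : ℕ} (γ : Fin n → ℝ) {Ω : Type u} [MeasurableSpace Ω] (μ : Measure Ω)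
    (Ypot : Fin 2 → Fin ℓ → Ω → ℝ) (Dpot : Fin ℓ → Ω → Fin 2)
    (Y : Ω → ℝ) (D : Ω → Fin 2) (Z : Ω → Fin ℓ) : Prop where
  isProbabilityMeasure : IsProbabilityMeasure μ
  measurable_Ypot : ∀ d z, Measurable (Ypot d z)
  measurable_Dpot : ∀ z, Measurable (Dpot z)
  measurable_Y : Measurable Y
  measurable_D : Measurable D
  measurable_Z : Measurable Z
  /-- The outcome takes values in the finite set of the `γ i`. -/
  support : ∀ d z, ∀ᵐ ω ∂μ, Ypot d z ω ∈ Set.range γ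
  /-- Individual-level exclusion. -/
  exclusion : ∀ d z z', Ypot d z =ᵐ[μ] Ypot d z'
  /-- Random assignment: `Z` is independent of `(Y^(0), Y^(1), D^(0), …, D^(ℓ-1))`. -/
  randomAssignment : ∀ z₀,
    IndepFun Z (fun ω => (Ypot 0 z₀ ω, Ypot 1 z₀ ω, fun z => Dpot z ω)) μ
  /-- Consistency of the outcome: `Y = (1 - D) Y^(0) + D Y^(1)`. -/
  consistency_Y : ∀ z₀, ∀ᵐ ω ∂μ,
    Y ω = (1 - ((D ω : ℕ) : ℝ)) * Ypot 0 z₀ ω + ((D ω : ℕ) : ℝ) * Ypot 1 z₀ ω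
  /-- Consistency of the treatment: `D = ∑ z, 1(Z = z) D^(z)`. -/
  consistency_D : ∀ᵐ ω ∂μ,
    ((D ω : ℕ) : ℝ) = ∑ z, if Z ω = z then ((Dpot z ω : ℕ) : ℝ) else 0

/-- An observed law, i.e. a law of `(Y, D, Z)`: the outcome has support in `{γ i}` and every value
of the instrument has positive probability. -/
structure IsObservedLaw {n ℓ : ℕ} (γ : Fin n → ℝ) (P : Measure (ℝ × Fin 2 × Fin ℓ)) : Prop where
  isProbabilityMeasure : IsProbabilityMeasure P
  support : ∀ᵐ o ∂P, o.1 ∈ Set.range γ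
  instrument_pos : ∀ z, 0 < P {o | o.2.2 = z}

/-- The IV model is compatible with the observed law `P`: some full data distribution following
the IV model induces `P` as the law of `(Y, D, Z)`. -/
def IVCompatible {n ℓ : ℕ} (γ : Fin n → ℝ) (P : Measure (ℝ × Fin 2 × Fin ℓ)) : Prop :=
  ∃ (Ω : Type u) (_ : MeasurableSpace Ω) (μ : Measure Ω)
    (Ypot : Fin 2 → Fin ℓ → Ω → ℝ) (Dpot : Fin ℓ → Ω → Fin 2)
    (Y : Ω → ℝ) (D : Ω → Fin 2) (Z : Ω → Fin ℓ),
    IsIVModel γ μ Ypot Dpot Y D Z ∧ μ.map (fun ω => (Y ω, D ω, Z ω)) = P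

/-- `p_{yd,z} = P(Y = γ_y, D = d | Z = z)`. -/
noncomputable def condProb {n ℓ : ℕ} (γ : Fin n → ℝ) (P : Measure (ℝ × Fin 2 × Fin ℓ))
    (y : Fin n) (d : Fin 2) (z : Fin ℓ) : ℝ :=
  (ProbabilityTheory.cond P {o | o.2.2 = z}).real {o | o.1 = γ y ∧ o.2.1 = d}

/-- `∑_k -p_{k0,1} + ∑_{k ∈ T} (p_{k1,0} - p_{k1,1})`. -/
def ivForm₁ {n : ℕ} (T : Finset (Fin n)) (p : Fin n → Fin 2 → Fin 2 → ℝ) : ℝ :=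
  (∑ k, -p k 0 1) + ∑ k ∈ T, (p k 1 0 - p k 1 1)

/-- `∑_k -p_{k1,0} + ∑_{k ∈ T} (p_{k0,1} - p_{k0,0})`. -/
def ivForm₂ {n : ℕ} (T : Finset (Fin n)) (p : Fin n → Fin 2 → Fin 2 → ℝ) : ℝ :=
  (∑ k, -p k 1 0) + ∑ k ∈ T, (p k 0 1 - p k 0 0)

/-- `∑_k -p_{k0,0} + ∑_{k ∈ T} (p_{k1,1} - p_{k1,0})`. -/
def ivForm₃ {n : ℕ} (T : Finset (Fin n)) (p : Fin n → Fin 2 → Fin 2 → ℝ) : ℝ :=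
  (∑ k, -p k 0 0) + ∑ k ∈ T, (p k 1 1 - p k 1 0)

/-- The set of linear forms `L` in `(p_{yd,z})` whose inequalities `L p ≤ 0` are the IV
inequalities: the first and third families are indexed by the nonempty `T ⊆ {0, …, n-2}`, the
second by the nonempty proper subsets `T` of `{0, …, n-1}`. -/
def ivForms (n : ℕ) : Set ((Fin n → Fin 2 → Fin 2 → ℝ) → ℝ) :=
  {L | ∃ T : Finset (Fin n), T.Nonempty ∧ (∀ k ∈ T, (k : ℕ) + 1 < n) ∧ L = ivForm₁ T} ∪
  {L | ∃ T : Finset (Fin n), T.Nonempty ∧ T ⊂ Finset.univ ∧ L = ivForm₂ T} ∪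
  {L | ∃ T : Finset (Fin n), T.Nonempty ∧ (∀ k ∈ T, (k : ℕ) + 1 < n) ∧ L = ivForm₃ T}

/-! Once the entries for each `z` sum to 1, every inequality becomes `∑ k, p k d (z k) ≤ 1`, for a
treatment `d` and a nonconstant choice `k ↦ z k`; encoding the choice by `S = {k | z k = 0}` gives
two times `2 ^ n - 2` cases (`ivForms_eq_image`, `ivFacet_apply`). Constant choices hold trivially.

Necessity: `p k d (z k)` is the probability of `Y^(d) = γ k, D^(z k) = d`, and these events are
disjoint in `k`. Sufficiency: choosing the larger entry at each `k` gives `∑ k, max_z p k d z ≤ 1`,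
which is exactly what is needed to split the mass among the four types `(D^(0), D^(1))`
(`exists_joint_weights`).

For each `(d, S)` an explicit table violates that inequality alone (`exists_violating_only`). This
gives irredundancy, and also distinctness, since equal forms cannot be separated by a table. -/

/-- The instrumental variable form which on normalized tables `p` equals `∑ k, p k d (z k) - 1`, where
`z k = 0` for `k ∈ S` and `z k = 1` otherwise. -/
noncomputable def ivFacet {n : ℕ} (d : Fin 2) (S : Finset (Fin n)) :
    (Fin n → Fin 2 → Fin 2 → ℝ) → ℝ :=
  open Classical in
  if d = 0 then ivForm₂ Sᶜ else if ∀ k ∈ S, (k : ℕ) + 1 < n then ivForm₁ S else ivForm₃ Sᶜ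

/-! ### The inequalities as choices of an instrument value for each outcome -/

/-- For `d = 1`, exactly one of `S` and `Sᶜ` avoids the last index `n - 1`: the first family covers
the case `S`, the third the case `Sᶜ`. -/
theorem ivForms_eq_image {n : ℕ} :
    ivForms n = (fun x : Fin 2 × Finset (Fin n) => ivFacet x.1 x.2) ''
      {x | x.2.Nonempty ∧ x.2 ≠ Finset.univ} := by
  ext L
  constructor
  · rintro ((⟨T, hT, hlt, rfl⟩ | ⟨T, hT, hss, rfl⟩) | ⟨T, hT, hlt, rfl⟩)
    · refine ⟨(1, T), ⟨hT, ?_⟩, by simp only [ivFacet, one_ne_zero, if_false, if_pos hlt]⟩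
      rintro h
      obtain ⟨k, hk⟩ := hT
      have h1 := hlt ⟨n - 1, by have := k.2; omega⟩ (by simp only at h; simp [h])
      simp only at h1
      omega
    · refine ⟨(0, Tᶜ), ⟨?_, ?_⟩, by simp [ivFacet]⟩
      · rw [Finset.nonempty_iff_ne_empty]
        simpa using hss.ne
      · simpa using hT.ne_empty
    · obtain ⟨k, hk⟩ := hT
      have hlast : (⟨n - 1, by have := k.2; omega⟩ : Fin n) ∈ Tᶜ := by
        rw [Finset.mem_compl]
        intro h
        have := hlt _ h
        simp only at this
        omega
      refine ⟨(1, Tᶜ), ⟨⟨_, hlast⟩, ?_⟩, ?_⟩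
      · simpa using Finset.ne_empty_of_mem hk
      · have : ¬ ∀ k ∈ Tᶜ, (k : ℕ) + 1 < n := by
          intro h
          have := h _ hlast
          simp only at this
          omega
        simp only [ivFacet, if_neg this]
        simp
  · rintro ⟨⟨d, S⟩, ⟨hS, hS'⟩, rfl⟩
    simp only at hS hS'
    have hne : Sᶜ.Nonempty := by
      rw [Finset.nonempty_iff_ne_empty]
      simpa using hS'
    by_cases hd : d = 0
    · refine Or.inl (Or.inr ⟨Sᶜ, hne, ?_, by simp [ivFacet, hd]⟩)
      rw [Finset.ssubset_univ_iff]
      simpa using hS.ne_empty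
    · by_cases hlt : ∀ k ∈ S, (k : ℕ) + 1 < n
      · exact Or.inl (Or.inl ⟨S, hS, hlt, by simp only [ivFacet, if_neg hd, if_pos hlt]⟩)
      · refine Or.inr ⟨Sᶜ, hne, ?_, by simp only [ivFacet, if_neg hd, if_neg hlt]⟩
        push Not at hlt
        obtain ⟨j, hj, hjn⟩ := hlt
        intro k hk
        by_contra hkn
        have : k = j := Fin.ext (by have := j.2; have := k.2; omega)
        exact (Finset.mem_compl.1 hk) (this ▸ hj)

theorem ivFacet_apply {n : ℕ} (d : Fin 2) (S : Finset (Fin n)) {p : Fin n → Fin 2 → Fin 2 → ℝ}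
    (hp : ∀ z, ∑ k, (p k 0 z + p k 1 z) = 1) :
    ivFacet d S p = ∑ k, p k d (if k ∈ S then 0 else 1) - 1 := by
  have h0 := hp 0
  have h1 := hp 1
  have hsum : ∑ k, p k d (if k ∈ S then 0 else 1) = ∑ k ∈ S, p k d 0 + ∑ k ∈ Sᶜ, p k d 1 := by
    rw [← Finset.sum_add_sum_compl S]
    congr 1
    · exact Finset.sum_congr rfl fun k hk => by simp [hk]
    · exact Finset.sum_congr rfl fun k hk => by simp [Finset.mem_compl.1 hk]
  rw [hsum]
  rw [Finset.sum_add_distrib] at h0 h1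
  have key : ∀ d z, ∑ k ∈ S, p k d z + ∑ k ∈ Sᶜ, p k d z = ∑ k, p k d z :=
    fun d z => Finset.sum_add_sum_compl S _
  have k00 := key 0 0
  have k01 := key 0 1
  have k10 := key 1 0
  have k11 := key 1 1
  rcases Fin.exists_fin_two.1 ⟨d, rfl⟩ with rfl | rfl
  · simp only [ivFacet, if_true, ivForm₂, Finset.sum_neg_distrib, Finset.sum_sub_distrib]
    linarith
  · simp only [ivFacet, one_ne_zero, if_false]
    split_ifs
    · simp only [ivForm₁, Finset.sum_neg_distrib, Finset.sum_sub_distrib]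
      linarith
    · simp only [ivForm₃, Finset.sum_neg_distrib, Finset.sum_sub_distrib]
      linarith

/-! ### Irredundancy -/

/-- For each facet some normalized nonnegative table violates it and satisfies all the others. -/
theorem exists_violating_only {n : ℕ} (d₀ : Fin 2) {S : Finset (Fin n)} (hS : S.Nonempty)
    (hS' : S ≠ Finset.univ) :
    ∃ p : Fin n → Fin 2 → Fin 2 → ℝ, (∀ k d z, 0 ≤ p k d z) ∧
      (∀ z, ∑ k, (p k 0 z + p k 1 z) = 1) ∧
      1 < ∑ k, p k d₀ (if k ∈ S then 0 else 1) ∧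
      ∀ d S', (d, S') ≠ (d₀, S) → ∑ k, p k d (if k ∈ S' then 0 else 1) ≤ 1 := by
  have hne : Sᶜ.Nonempty := by
    rw [Finset.nonempty_iff_ne_empty]
    simpa using hS'
  have hn : (1 : ℝ) ≤ n := by
    obtain ⟨k, -⟩ := hS
    exact_mod_cast (by have := k.2; omega : 1 ≤ n)
  -- `β` solves `2 * β - β / n = 1`: the chosen facet gets total `2 * β > 1`, and losing a single
  -- weight, each at least `β / n`, brings it down to at most 1.
  set β : ℝ := n / (2 * n - 1) with hβ
  have hden : (0 : ℝ) < 2 * n - 1 := by linarith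
  have hβ0 : 0 < β := by positivity
  have hβ1 : β ≤ 1 := by rw [hβ, div_le_one hden]; linarith
  have hβ2 : 1 < 2 * β := by
    rw [hβ, ← mul_div_assoc, lt_div_iff₀ hden]; linarith
  have hβn : 2 * β - β / n = 1 := by
    rw [hβ]; field_simp
  have hcS : (0 : ℝ) < S.card := by exact_mod_cast hS.card_pos
  have hcS' : (0 : ℝ) < Sᶜ.card := by exact_mod_cast hne.card_pos
  have hleS : (S.card : ℝ) ≤ n := by exact_mod_cast card_finset_fin_le S
  have hleS' : (Sᶜ.card : ℝ) ≤ n := by exact_mod_cast card_finset_fin_le Sᶜ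
  set w : Fin n → ℝ := fun k => if k ∈ S then β / S.card else β / Sᶜ.card with hw
  have hwn : ∀ k, β / n ≤ w k := by
    intro k
    simp only [hw]
    split_ifs
    · gcongr
    · gcongr
  have hw0 : ∀ k, 0 ≤ w k := fun k => le_trans (by positivity) (hwn k)
  have hwS : ∑ k ∈ S, w k = β := by
    rw [Finset.sum_congr rfl (g := fun _ => β / S.card) fun k hk => by simp [hw, hk]]
    rw [Finset.sum_const, nsmul_eq_mul]
    field_simp
  have hwS' : ∑ k ∈ Sᶜ, w k = β := by
    rw [Finset.sum_congr rfl (g := fun _ => β / Sᶜ.card) fun k hk => by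
      simp [hw, Finset.mem_compl.1 hk]]
    rw [Finset.sum_const, nsmul_eq_mul]
    field_simp
  set v : Fin n → Fin 2 → ℝ := fun k z => if z = (if k ∈ S then 0 else 1) then w k else 0 with hv
  have hv0 : ∀ k z, 0 ≤ v k z := by
    intro k z
    simp only [hv]
    split_ifs <;> simp [hw0]
  have hvw : ∀ k z, v k z ≤ w k := by
    intro k z
    simp only [hv]
    split_ifs <;> simp [hw0]
  have hvsum : ∀ z, ∑ k, v k z = β := by
    intro z
    rw [← Finset.sum_add_sum_compl S]
    rcases Fin.exists_fin_two.1 ⟨z, rfl⟩ with rfl | rfl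
    · rw [Finset.sum_congr rfl (g := w) fun k hk => by simp [hv, hk],
        Finset.sum_congr (s₁ := Sᶜ) rfl (g := 0) fun k hk => by simp [hv, Finset.mem_compl.1 hk], hwS]
      simp
    · rw [Finset.sum_congr rfl (g := 0) fun k hk => by simp [hv, hk],
        Finset.sum_congr (s₁ := Sᶜ) rfl (g := w) fun k hk => by simp [hv, Finset.mem_compl.1 hk], hwS']
      simp
  have hrest : ∑ _k : Fin n, (1 - β) / n = 1 - β := by
    rw [Finset.sum_const, nsmul_eq_mul, Finset.card_univ, Fintype.card_fin]
    field_simp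
  have hwsum : ∑ k, w k = 2 * β := by
    rw [← Finset.sum_add_sum_compl S, hwS, hwS']; ring
  refine ⟨fun k d z => if d = d₀ then v k z else (1 - β) / n, ?_, ?_, ?_, ?_⟩
  · intro k d z
    dsimp only
    split_ifs
    · exact hv0 k z
    · exact div_nonneg (by linarith) (by linarith)
  · intro z
    rw [Finset.sum_add_distrib]
    rcases Fin.exists_fin_two.1 ⟨d₀, rfl⟩ with rfl | rfl
    · simp only [if_true, one_ne_zero, if_false, hrest, hvsum]; ring
    · simp only [if_true, zero_ne_one, if_false, hrest, hvsum]; ring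
  · simp only [if_true]
    rw [Finset.sum_congr rfl (g := w) fun k _ => by simp [hv], hwsum]
    exact hβ2
  · intro d S' hne'
    by_cases hd : d = d₀
    · subst hd
      have hSS : S' ≠ S := fun h => hne' (by rw [h])
      -- Where `S'` and `S` disagree, `S'` selects the zero entry and forfeits `w j`.
      obtain ⟨j, hj⟩ : ∃ j, ¬ (j ∈ S' ↔ j ∈ S) := by
        by_contra h
        push Not at h
        exact hSS (Finset.ext h)
      simp only [if_true]
      have hvj : v j (if j ∈ S' then 0 else 1) = 0 := by
        by_cases h1 : j ∈ S <;> by_cases h2 : j ∈ S' <;> simp_all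
      rw [← Finset.add_sum_erase _ _ (Finset.mem_univ j), hvj]
      rw [← Finset.add_sum_erase _ _ (Finset.mem_univ j)] at hwsum
      have := Finset.sum_le_sum fun k (_ : k ∈ Finset.univ.erase j) =>
        hvw k (if k ∈ S' then 0 else 1)
      have := hwn j
      linarith
    · simp only [if_neg hd, hrest]
      linarith

/-! ### Couplings and the joint law of the potential variables -/

/-- The normalized product works; if the total mass is zero, all marginals vanish and division by
zero returns 0. -/
theorem exists_coupling {ι κ : Type*} [Fintype ι] [Fintype κ] {x : ι → ℝ} {y : κ → ℝ}
    (hx : ∀ i, 0 ≤ x i) (hy : ∀ j, 0 ≤ y j) (h : ∑ i, x i = ∑ j, y j) :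
    ∃ r : ι → κ → ℝ, (∀ i j, 0 ≤ r i j) ∧ (∀ i, ∑ j, r i j = x i) ∧ ∀ j, ∑ i, r i j = y j := by
  have hs : 0 ≤ ∑ i, x i := Finset.sum_nonneg fun i _ => hx i
  refine ⟨fun i j => x i * y j / ∑ i, x i,
    fun i j => div_nonneg (mul_nonneg (hx i) (hy j)) hs, ?_, ?_⟩
  · intro i
    rw [← Finset.sum_div, ← Finset.mul_sum, ← h]
    rcases eq_or_ne (∑ i, x i) 0 with h0 | h0
    · rw [h0, div_zero, (Finset.sum_eq_zero_iff_of_nonneg fun i _ => hx i).1 h0 i (Finset.mem_univ i)]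
    · field_simp
  · intro j
    rw [← Finset.sum_div, ← Finset.sum_mul]
    rcases eq_or_ne (∑ i, x i) 0 with h0 | h0
    · rw [h0, div_zero, (Finset.sum_eq_zero_iff_of_nonneg fun i _ => hy i).1 (h ▸ h0) j
        (Finset.mem_univ j)]
    · field_simp

theorem exists_le_sum_eq {ι : Type*} [Fintype ι] {m : ι → ℝ} (hm : ∀ i, 0 ≤ m i) {t : ℝ}
    (ht : 0 ≤ t) (htm : t ≤ ∑ i, m i) :
    ∃ u : ι → ℝ, (∀ i, 0 ≤ u i) ∧ (∀ i, u i ≤ m i) ∧ ∑ i, u i = t := by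
  have hs : 0 ≤ ∑ i, m i := Finset.sum_nonneg fun i _ => hm i
  refine ⟨fun i => t / (∑ i, m i) * m i, fun i => mul_nonneg (div_nonneg ht hs) (hm i), ?_, ?_⟩
  · exact fun i => mul_le_of_le_one_left (hm i) (div_le_one_of_le₀ htm hs)
  · rw [← Finset.mul_sum]
    rcases eq_or_ne (∑ i, m i) 0 with h0 | h0
    · rw [h0] at htm ⊢
      linarith
    · field_simp

/-- A table of conditional probabilities satisfying `∑ k, max_z p k d z ≤ 1` for both `d` comes from
a joint distribution `q i j s t` of potential outcomes `Y^(0) = i`, `Y^(1) = j` and potential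
treatments `D^(0) = s`, `D^(1) = t`. -/
theorem exists_joint_weights {n : ℕ} {p : Fin n → Fin 2 → Fin 2 → ℝ}
    (hp0 : ∀ k d z, 0 ≤ p k d z) (hp1 : ∀ z, ∑ k, (p k 0 z + p k 1 z) = 1)
    (hmax : ∀ d, ∑ k, max (p k d 0) (p k d 1) ≤ 1) :
    ∃ q : Fin n → Fin n → Fin 2 → Fin 2 → ℝ, (∀ i j s t, 0 ≤ q i j s t) ∧
      (∀ k, ∑ j, ∑ t, q k j 0 t = p k 0 0) ∧ (∀ k, ∑ i, ∑ t, q i k 1 t = p k 1 0) ∧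
      (∀ k, ∑ j, ∑ s, q k j s 0 = p k 0 1) ∧ (∀ k, ∑ i, ∑ s, q i k s 1 = p k 1 1) := by
  have hn : (n : ℝ) ≠ 0 := by
    rintro h
    have : n = 0 := by exact_mod_cast h
    subst this
    simpa using hp1 0
  have hsum : ∀ d, ∑ k, max (p k d 0) (p k d 1) + ∑ k, min (p k d 0) (p k d 1) =
      ∑ k, p k d 0 + ∑ k, p k d 1 := by
    intro d
    rw [← Finset.sum_add_distrib, ← Finset.sum_add_distrib]
    exact Finset.sum_congr rfl fun k _ => max_add_min _ _
  have hs0 := hsum 0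
  have hs1 := hsum 1
  have hm0 := hmax 0
  have hm1 := hmax 1
  have hz0 := hp1 0
  have hz1 := hp1 1
  rw [Finset.sum_add_distrib] at hz0 hz1
  have hmin : ∀ d k, 0 ≤ min (p k d 0) (p k d 1) := fun d k => le_min (hp0 _ _ _) (hp0 _ _ _)
  have hminsum : ∀ d, 0 ≤ ∑ k, min (p k d 0) (p k d 1) :=
    fun d => Finset.sum_nonneg fun k _ => hmin d k
  -- `u` is the law of `Y^(0)` on type `(0, 0)` and `v` that of `Y^(1)` on type `(1, 1)`. The
  -- remaining marginals on the mixed types have equal mass exactly when `∑ u - ∑ v = c`; the bounds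
  -- on the maxima leave room for the positive and negative parts of `c`.
  set c := ∑ k, p k 0 0 + ∑ k, p k 0 1 - 1 with hc
  obtain ⟨u, hu0, hu, hus⟩ := exists_le_sum_eq (hmin 0) (t := max c 0) (le_max_right _ _)
    (max_le (by linarith) (hminsum 0))
  obtain ⟨v, hv0, hv, hvs⟩ := exists_le_sum_eq (hmin 1) (t := max (-c) 0) (le_max_right _ _)
    (max_le (by linarith) (hminsum 1))
  have huv : ∑ k, u k - ∑ k, v k = c := by
    rw [hus, hvs]
    rcases le_total 0 c with h | h
    · rw [max_eq_left h, max_eq_right (by linarith)]; ring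
    · rw [max_eq_right h, max_eq_left (by linarith)]; ring
  obtain ⟨r, hr0, hr1, hr2⟩ := exists_coupling (x := fun k => p k 0 0 - u k)
    (y := fun k => p k 1 1 - v k) (fun k => sub_nonneg.2 ((hu k).trans (min_le_left _ _)))
    (fun k => sub_nonneg.2 ((hv k).trans (min_le_right _ _)))
    (by rw [Finset.sum_sub_distrib, Finset.sum_sub_distrib]; linarith)
  obtain ⟨s, hs0, hs1, hs2⟩ := exists_coupling (x := fun k => p k 0 1 - u k)
    (y := fun k => p k 1 0 - v k) (fun k => sub_nonneg.2 ((hu k).trans (min_le_right _ _)))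
    (fun k => sub_nonneg.2 ((hv k).trans (min_le_left _ _)))
    (by rw [Finset.sum_sub_distrib, Finset.sum_sub_distrib]; linarith)
  have hconst : ∀ a : ℝ, ∑ _k : Fin n, a / n = a := by
    intro a
    rw [Finset.sum_const, nsmul_eq_mul, Finset.card_univ, Fintype.card_fin]
    field_simp
  -- Rows are `D^(0)`, columns `D^(1)`. On the diagonal types the never observed outcome is taken
  -- uniform.
  refine ⟨fun i j => ![![u i / n, r i j], ![s i j, v j / n]], ?_, ?_, ?_, ?_, ?_⟩
  · intro i j s t
    fin_cases s <;> fin_cases t <;> simp [hr0, hs0, div_nonneg, hu0, hv0]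
  all_goals
    intro k
    simp [Fin.sum_univ_two, Finset.sum_add_distrib, hconst, hr1, hr2, hs1, hs2, -Finset.sum_const]

/-! ### Finitely supported measures -/

/-- The discrete measure putting weight `w x` on the point `f x`. -/
noncomputable def weightedDirac {α β : Type*} [Fintype α] [MeasurableSpace β] (f : α → β)
    (w : α → ℝ) : Measure β :=
  ∑ x, ENNReal.ofReal (w x) • Measure.dirac (f x)

theorem weightedDirac_apply {α β : Type*} [Fintype α] [MeasurableSpace β] (f : α → β)
    {w : α → ℝ} (hw : ∀ x, 0 ≤ w x) {s : Set β} [DecidablePred (· ∈ s)] (hs : MeasurableSet s) :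
    weightedDirac f w s = ENNReal.ofReal (∑ x, if f x ∈ s then w x else 0) := by
  rw [ENNReal.ofReal_sum_of_nonneg fun x _ => by split_ifs <;> simp [hw], weightedDirac,
    Measure.finsetSum_apply]
  refine Finset.sum_congr rfl fun x _ => ?_
  rw [Measure.smul_apply, Measure.dirac_apply' _ hs]
  by_cases h : f x ∈ s <;> simp [h]

theorem weightedDirac_real_apply {α β : Type*} [Fintype α] [MeasurableSpace β] (f : α → β)
    {w : α → ℝ} (hw : ∀ x, 0 ≤ w x) {s : Set β} [DecidablePred (· ∈ s)] (hs : MeasurableSet s) :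
    (weightedDirac f w).real s = ∑ x, if f x ∈ s then w x else 0 := by
  rw [measureReal_def, weightedDirac_apply f hw hs, ENNReal.toReal_ofReal]
  exact Finset.sum_nonneg fun x _ => by split_ifs <;> simp [hw]

theorem isProbabilityMeasure_weightedDirac {α β : Type*} [Fintype α] [MeasurableSpace β]
    (f : α → β) {w : α → ℝ} (hw : ∀ x, 0 ≤ w x) (h1 : ∑ x, w x = 1) :
    IsProbabilityMeasure (weightedDirac f w) := by
  classical
  exact ⟨by simp [weightedDirac_apply f hw MeasurableSet.univ, h1]⟩

theorem measure_ext_of_finite_support {α : Type*} [MeasurableSpace α] [MeasurableSingletonClass α]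
    {P Q : Measure α} {R : Set α} (hR : R.Finite) (hP : ∀ᵐ x ∂P, x ∈ R) (hQ : ∀ᵐ x ∂Q, x ∈ R)
    (h : ∀ x ∈ R, P {x} = Q {x}) : P = Q := by
  ext s -
  have key : ∀ M : Measure α, (∀ᵐ x ∂M, x ∈ R) →
      M s = ∑ x ∈ (hR.inter_of_right s).toFinset, M {x} := by
    intro M hM
    rw [sum_measure_singleton, Set.Finite.coe_toFinset]
    refine measure_congr ?_
    filter_upwards [hM] with x hx
    exact propext ⟨fun hs => ⟨hs, hx⟩, fun hs => hs.1⟩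
  rw [key P hP, key Q hQ]
  refine Finset.sum_congr rfl fun x hx => h x ?_
  rw [Set.Finite.mem_toFinset] at hx
  exact hx.2

/-! ### Observed laws and their conditional probabilities -/

theorem setOf_instrument_inter {ℓ : ℕ} (t : ℝ) (d : Fin 2) (z : Fin ℓ) :
    {o : ℝ × Fin 2 × Fin ℓ | o.2.2 = z} ∩ {o | o.1 = t ∧ o.2.1 = d} = {(t, d, z)} := by
  ext ⟨y, d', z'⟩
  simp only [Set.mem_inter_iff, Set.mem_ofPred_eq, Set.mem_singleton_iff, Prod.mk.injEq]
  tauto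

theorem measurableSet_instrument {ℓ : ℕ} (z : Fin ℓ) :
    MeasurableSet {o : ℝ × Fin 2 × Fin ℓ | o.2.2 = z} :=
  (measurable_snd.comp measurable_snd) (measurableSet_singleton z)

theorem condProb_eq {n ℓ : ℕ} (γ : Fin n → ℝ) (P : Measure (ℝ × Fin 2 × Fin ℓ))
    (y : Fin n) (d : Fin 2) (z : Fin ℓ) :
    condProb γ P y d z = (P.real {o | o.2.2 = z})⁻¹ * P.real {(γ y, d, z)} := by
  rw [condProb, measureReal_def, cond_apply (measurableSet_instrument z), setOf_instrument_inter,
    ENNReal.toReal_mul, ENNReal.toReal_inv, measureReal_def, measureReal_def]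

theorem condProb_nonneg {n ℓ : ℕ} (γ : Fin n → ℝ) (P : Measure (ℝ × Fin 2 × Fin ℓ))
    (y : Fin n) (d : Fin 2) (z : Fin ℓ) : 0 ≤ condProb γ P y d z :=
  measureReal_nonneg

namespace IsObservedLaw

variable {n ℓ : ℕ} {γ : Fin n → ℝ} {P : Measure (ℝ × Fin 2 × Fin ℓ)}

theorem instrument_real_pos (h : IsObservedLaw γ P) (z : Fin ℓ) :
    0 < P.real {o | o.2.2 = z} := by
  have := h.isProbabilityMeasure
  exact ENNReal.toReal_pos (h.instrument_pos z).ne' (measure_ne_top _ _)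

theorem singleton_eq (h : IsObservedLaw γ P) (y : Fin n) (d : Fin 2) (z : Fin ℓ) :
    P {(γ y, d, z)} = ENNReal.ofReal (condProb γ P y d z) * P {o | o.2.2 = z} := by
  have := h.isProbabilityMeasure
  have hz := h.instrument_real_pos z
  rw [condProb_eq, ENNReal.ofReal_mul (inv_nonneg.2 hz.le), mul_right_comm, ofReal_measureReal,
    ENNReal.ofReal_inv_of_pos hz, ofReal_measureReal,
    ENNReal.inv_mul_cancel (h.instrument_pos z).ne' (measure_ne_top _ _), one_mul]

theorem sum_condProb (h : IsObservedLaw γ P) (hγ : StrictMono γ) (z : Fin ℓ) :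
    ∑ k, (condProb γ P k 0 z + condProb γ P k 1 z) = 1 := by
  have := h.isProbabilityMeasure
  have hz := h.instrument_real_pos z
  have hsum : ∑ k, (condProb γ P k 0 z + condProb γ P k 1 z) =
      (P.real {o | o.2.2 = z})⁻¹ * ∑ x : Fin n × Fin 2, P.real {(γ x.1, x.2, z)} := by
    simp only [condProb_eq, Fintype.sum_prod_type, Fin.sum_univ_two, Finset.mul_sum, mul_add]
  have hinj : Function.Injective fun x : Fin n × Fin 2 => (γ x.1, x.2, z) := by
    rintro ⟨a, b⟩ ⟨a', b'⟩ hab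
    simp only [Prod.mk.injEq, hγ.injective.eq_iff] at hab
    simp [hab.1, hab.2.1]
  have htot : ∑ x : Fin n × Fin 2, P.real {(γ x.1, x.2, z)} = P.real {o | o.2.2 = z} := by
    rw [← measureReal_biUnion_finset (fun a _ b _ hab => by
      simpa using fun h1 h2 => hab (hinj (by simp [h1, h2])))
      fun x _ => measurableSet_singleton _]
    refine measureReal_congr ?_
    filter_upwards [h.support] with ⟨y, d, z'⟩ ⟨k, hk⟩
    simp only at hk
    subst hk
    refine propext ?_
    change (_ ∈ ⋃ _, _) ↔ z' = z
    simp [hγ.injective.eq_iff]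
    tauto
  rw [hsum, htot, inv_mul_cancel₀ hz.ne']

end IsObservedLaw

theorem exists_observedLaw {n : ℕ} {γ : Fin n → ℝ} (hγ : StrictMono γ)
    {p : Fin n → Fin 2 → Fin 2 → ℝ} (hp0 : ∀ k d z, 0 ≤ p k d z)
    (hp1 : ∀ z, ∑ k, (p k 0 z + p k 1 z) = 1) :
    ∃ P : Measure (ℝ × Fin 2 × Fin 2), IsObservedLaw γ P ∧ condProb γ P = p := by
  classical
  set f : Fin n × Fin 2 × Fin 2 → ℝ × Fin 2 × Fin 2 := fun x => (γ x.1, x.2.1, x.2.2) with hf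
  -- The instrument is a fair coin.
  set w : Fin n × Fin 2 × Fin 2 → ℝ := fun x => p x.1 x.2.1 x.2.2 / 2 with hw
  have hw0 : ∀ x, 0 ≤ w x := fun x => div_nonneg (hp0 _ _ _) zero_le_two
  have hz : ∀ z, (weightedDirac f w).real {o | o.2.2 = z} = 1 / 2 := by
    intro z
    rw [weightedDirac_real_apply f hw0 (measurableSet_instrument z)]
    simp only [hf, hw, Set.mem_ofPred_eq, Fintype.sum_prod_type]
    rw [← hp1 z, Finset.sum_div]
    refine Finset.sum_congr rfl fun k _ => ?_
    rw [Fin.sum_univ_two, Finset.sum_ite_eq' Finset.univ z, Finset.sum_ite_eq' Finset.univ z]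
    simp only [Finset.mem_univ, if_true]
    ring
  refine ⟨weightedDirac f w, ⟨?_, ?_, ?_⟩, ?_⟩
  · refine isProbabilityMeasure_weightedDirac f hw0 ?_
    have h0 := hp1 0
    have h1 := hp1 1
    simp only [Finset.sum_add_distrib] at h0 h1
    simp only [hw, Fintype.sum_prod_type, Fin.sum_univ_two, Finset.sum_add_distrib,
      ← Finset.sum_div]
    linarith
  · rw [ae_iff, weightedDirac_apply f hw0]
    · rw [ENNReal.ofReal_eq_zero]
      exact (Finset.sum_eq_zero fun x _ => if_neg (by simp [hf])).le
    · exact ((Set.finite_range γ).measurableSet.preimage measurable_fst).compl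
  · intro z
    by_contra h
    have := hz z
    rw [measureReal_def, nonpos_iff_eq_zero.1 (not_lt.1 h)] at this
    norm_num at this
  · funext y d z
    rw [condProb_eq, hz, weightedDirac_real_apply f hw0 (measurableSet_singleton _)]
    rw [Finset.sum_eq_single (y, d, z)]
    · simp only [hf, hw, Set.mem_singleton_iff, if_true]
      ring
    · rintro ⟨y', d', z'⟩ - hne
      rw [if_neg]
      simp only [hf, Set.mem_singleton_iff, Prod.mk.injEq, hγ.injective.eq_iff]
      simpa using hne
    · simp

/-! ### Necessity -/

namespace IsIVModel

variable {n ℓ : ℕ} {γ : Fin n → ℝ} {Ω : Type u} [MeasurableSpace Ω] {μ : Measure Ω}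
  {Ypot : Fin 2 → Fin ℓ → Ω → ℝ} {Dpot : Fin ℓ → Ω → Fin 2}
  {Y : Ω → ℝ} {D : Ω → Fin 2} {Z : Ω → Fin ℓ}

theorem measurable_observed (h : IsIVModel γ μ Ypot Dpot Y D Z) :
    Measurable fun ω => (Y ω, D ω, Z ω) :=
  h.measurable_Y.prodMk (h.measurable_D.prodMk h.measurable_Z)

theorem ae_observed_iff (h : IsIVModel γ μ Ypot Dpot Y D Z) (z₀ : Fin ℓ) (t : ℝ) (d : Fin 2)
    (z : Fin ℓ) : ∀ᵐ ω ∂μ,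
      (Y ω, D ω, Z ω) = (t, d, z) ↔ Z ω = z ∧ Ypot d z₀ ω = t ∧ Dpot z ω = d := by
  filter_upwards [h.consistency_Y z₀, h.consistency_D] with ω hY hD
  have hD' : D ω = Dpot (Z ω) ω := by
    rw [Finset.sum_ite_eq Finset.univ (Z ω)] at hD
    simp only [Finset.mem_univ, if_true, Nat.cast_inj] at hD
    exact Fin.ext hD
  have hY' : Y ω = Ypot (D ω) z₀ ω := by
    rw [hY]
    rcases Fin.exists_fin_two.1 ⟨D ω, rfl⟩ with h0 | h0 <;> simp [h0]
  simp only [Prod.mk.injEq]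
  constructor
  · rintro ⟨h1, h2, h3⟩
    exact ⟨h3, by rw [← h1, hY', h2], by rw [← h2, hD', h3]⟩
  · rintro ⟨h1, h2, h3⟩
    have hDd : D ω = d := by rw [hD', h1, h3]
    exact ⟨by rw [hY', hDd, h2], hDd, h1⟩

theorem measure_inter_eq_mul (h : IsIVModel γ μ Ypot Dpot Y D Z) (z₀ : Fin ℓ) (t : ℝ) (d : Fin 2)
    (z : Fin ℓ) : μ {ω | Z ω = z ∧ Ypot d z₀ ω = t ∧ Dpot z ω = d} =
      μ {ω | Z ω = z} * μ {ω | Ypot d z₀ ω = t ∧ Dpot z ω = d} := by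
  have key := (h.randomAssignment z₀).measure_inter_preimage_eq_mul {z}
    {x | (if d = 0 then x.1 else x.2.1) = t ∧ x.2.2 z = d} (measurableSet_singleton z) ?_
  · rcases Fin.exists_fin_two.1 ⟨d, rfl⟩ with rfl | rfl <;> exact key
  · refine MeasurableSet.inter (?_ : MeasurableSet {x : ℝ × ℝ × (Fin ℓ → Fin 2) | _})
      (?_ : MeasurableSet {x : ℝ × ℝ × (Fin ℓ → Fin 2) | _})
    · refine measurableSet_eq_fun ?_ measurable_const
      split_ifs <;> fun_prop
    · exact measurableSet_eq_fun (by fun_prop) measurable_const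

/-- Random assignment removes the conditioning on `Z = z`. The version index `z₀` is independent of
`z`, so one version of `Y^(d)` serves all instrument values. -/
theorem condProb_map (h : IsIVModel γ μ Ypot Dpot Y D Z)
    (hP : IsObservedLaw γ (μ.map fun ω => (Y ω, D ω, Z ω))) (z₀ : Fin ℓ) (k : Fin n) (d : Fin 2)
    (z : Fin ℓ) : condProb γ (μ.map fun ω => (Y ω, D ω, Z ω)) k d z =
      μ.real {ω | Ypot d z₀ ω = γ k ∧ Dpot z ω = d} := by
  have hz := hP.instrument_real_pos z
  rw [map_measureReal_apply h.measurable_observed (measurableSet_instrument z)] at hz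
  have heq : μ.real ((fun ω => (Y ω, D ω, Z ω)) ⁻¹' {(γ k, d, z)}) =
      μ.real {ω | Z ω = z} * μ.real {ω | Ypot d z₀ ω = γ k ∧ Dpot z ω = d} := by
    simp only [measureReal_def]
    rw [← ENNReal.toReal_mul, ← h.measure_inter_eq_mul]
    congr 1
    refine measure_congr ?_
    filter_upwards [h.ae_observed_iff z₀ (γ k) d z] with ω hω
    exact propext hω
  rw [condProb_eq, map_measureReal_apply h.measurable_observed (measurableSet_instrument z),
    map_measureReal_apply h.measurable_observed (measurableSet_singleton _), heq]
  exact inv_mul_cancel_left₀ hz.ne' _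

theorem sum_condProb_le_one (h : IsIVModel γ μ Ypot Dpot Y D Z)
    (hP : IsObservedLaw γ (μ.map fun ω => (Y ω, D ω, Z ω))) (hγ : StrictMono γ) (d : Fin 2)
    (z : Fin n → Fin ℓ) :
    ∑ k, condProb γ (μ.map fun ω => (Y ω, D ω, Z ω)) k d (z k) ≤ 1 := by
  have := h.isProbabilityMeasure
  rcases isEmpty_or_nonempty (Fin n) with hn | ⟨⟨k₀⟩⟩
  · simp
  -- Using the same version `z k₀` for every `k` is what makes the events disjoint.
  simp only [h.condProb_map hP (z k₀)]
  rw [← measureReal_biUnion_finset]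
  · exact measureReal_le_one
  · intro i _ j _ hij
    refine Set.disjoint_left.2 fun ω hi hj => hij (hγ.injective ?_)
    exact hi.1.symm.trans hj.1
  · intro k _
    exact (h.measurable_Ypot d _ (measurableSet_singleton (γ k))).inter
      (h.measurable_Dpot _ (measurableSet_singleton d))

end IsIVModel

/-! ### Sufficiency -/

/-- The sample space is a product of the potential variables, weighted by `exists_joint_weights`,
and the instrument with its law under `P`, so random assignment is built in. `ULift` only adjusts
the universe. -/
theorem IVCompatible.of_sum_max_le_one {n : ℕ} {γ : Fin n → ℝ} (hγ : StrictMono γ)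
    {P : Measure (ℝ × Fin 2 × Fin 2)} (hP : IsObservedLaw γ P)
    (hmax : ∀ d, ∑ k, max (condProb γ P k d 0) (condProb γ P k d 1) ≤ 1) :
    IVCompatible.{u} γ P := by
  classical
  have := hP.isProbabilityMeasure
  obtain ⟨q, hq0, hq00, hq10, hq01, hq11⟩ :=
    exists_joint_weights (condProb_nonneg γ P) (hP.sum_condProb hγ) hmax
  let A := Fin n × Fin n × Fin 2 × Fin 2
  let w : A → ℝ := fun x => q x.1 x.2.1 x.2.2.1 x.2.2.2
  have hw0 : ∀ x, 0 ≤ w x := fun x => hq0 _ _ _ _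
  have hw1 : ∑ x, w x = 1 := by
    rw [← hP.sum_condProb hγ 0, Finset.sum_add_distrib]
    simp only [← hq00, ← hq10]
    rw [Finset.sum_comm (f := fun k i => ∑ t, q i k 1 t), ← Finset.sum_add_distrib]
    simp only [w, A, Fintype.sum_prod_type, Fin.sum_univ_two (M := ℝ), Finset.sum_add_distrib]
  let ν : Measure (ULift.{u} A) := weightedDirac ULift.up w
  have hν : IsProbabilityMeasure ν := isProbabilityMeasure_weightedDirac _ hw0 hw1
  let ζ : Measure (Fin 2) := P.map fun o => o.2.2
  have hζm : Measurable fun o : ℝ × Fin 2 × Fin 2 => o.2.2 := measurable_snd.comp measurable_snd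
  have hζ : IsProbabilityMeasure ζ := Measure.isProbabilityMeasure_map hζm.aemeasurable
  let Yp : Fin 2 → ULift.{u} A → ℝ := fun d a => γ (if d = 0 then a.down.1 else a.down.2.1)
  let Dp : Fin 2 → ULift.{u} A → Fin 2 := fun z a => if z = 0 then a.down.2.2.1 else a.down.2.2.2
  have hYp : ∀ d, Measurable (Yp d) := fun d =>
    (measurable_of_finite fun a : A => γ (if d = 0 then a.1 else a.2.1)).comp measurable_down
  have hDp : ∀ z, Measurable (Dp z) := fun z =>
    (measurable_of_finite fun a : A => if z = 0 then a.2.2.1 else a.2.2.2).comp measurable_down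
  have hνatom : ∀ y d z, ν {a | Yp d a = γ y ∧ Dp z a = d} =
      ENNReal.ofReal (condProb γ P y d z) := by
    intro y d z
    have hm : MeasurableSet {a | Yp d a = γ y ∧ Dp z a = d} :=
      (hYp d (measurableSet_singleton _)).inter (hDp z (measurableSet_singleton _))
    rw [show ν = weightedDirac ULift.up w from rfl, weightedDirac_apply _ hw0 hm]
    congr 1
    rcases Fin.exists_fin_two.1 ⟨d, rfl⟩ with rfl | rfl <;>
    rcases Fin.exists_fin_two.1 ⟨z, rfl⟩ with rfl | rfl <;>
    simp [← hq00, ← hq10, ← hq01, ← hq11, Yp, Dp, w, A, Fintype.sum_prod_type,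
      hγ.injective.eq_iff, ite_and, Fin.sum_univ_two, Finset.sum_add_distrib,
      Finset.sum_ite_irrel]
  have hmD : Measurable fun ω : ULift.{u} A × Fin 2 => Dp ω.2 ω.1 :=
    measurable_from_prod_countable_left fun z => hDp z
  have hmY : Measurable fun ω : ULift.{u} A × Fin 2 => Yp (Dp ω.2 ω.1) ω.1 :=
    measurable_from_prod_countable_left fun z => by
      have : Measurable fun x : ULift.{u} A × Fin 2 => Yp x.2 x.1 :=
        measurable_from_prod_countable_left fun d => hYp d
      exact this.comp (measurable_id.prodMk (hDp z))
  have hmO : Measurable fun ω : ULift.{u} A × Fin 2 => (Yp (Dp ω.2 ω.1) ω.1, Dp ω.2 ω.1, ω.2) :=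
    hmY.prodMk (hmD.prodMk measurable_snd)
  refine ⟨ULift.{u} A × Fin 2, inferInstance, ν.prod ζ, fun d _ ω => Yp d ω.1,
    fun z ω => Dp z ω.1, fun ω => Yp (Dp ω.2 ω.1) ω.1, fun ω => Dp ω.2 ω.1, fun ω => ω.2, ?_, ?_⟩
  · refine
      { isProbabilityMeasure := inferInstance
        measurable_Ypot := fun d _ => (hYp d).comp measurable_fst
        measurable_Dpot := fun z => (hDp z).comp measurable_fst
        measurable_Y := hmY
        measurable_D := hmD
        measurable_Z := measurable_snd
        support := fun d _ => Filter.Eventually.of_forall fun ω => ⟨_, rfl⟩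
        exclusion := fun _ _ _ => Filter.EventuallyEq.rfl
        randomAssignment := fun _ => ?_
        consistency_Y := fun _ => Filter.Eventually.of_forall fun ω => ?_
        consistency_D := Filter.Eventually.of_forall fun ω => ?_ }
    · exact (indepFun_prod (X := fun a => (Yp 0 a, Yp 1 a, fun z => Dp z a)) (Y := fun z => z)
        ((hYp 0).prodMk ((hYp 1).prodMk (measurable_pi_lambda _ hDp))) measurable_id).symm
    · rcases Fin.exists_fin_two.1 ⟨Dp ω.2 ω.1, rfl⟩ with h0 | h0 <;> simp [h0]
    · simp
  · refine measure_ext_of_finite_support (R := {o | o.1 ∈ Set.range γ}) ?_ ?_ hP.support ?_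
    · exact ((Set.finite_range γ).prod (Set.finite_univ (α := Fin 2 × Fin 2))).subset
        fun o ho => ⟨ho, trivial⟩
    · refine (ae_map_iff hmO.aemeasurable
        ((Set.finite_range γ).measurableSet.preimage measurable_fst)).2 ?_
      exact Filter.Eventually.of_forall fun ω => ⟨_, rfl⟩
    · rintro ⟨_, d, z⟩ ⟨y, rfl⟩
      rw [Measure.map_apply hmO (measurableSet_singleton _)]
      have hpre : (fun ω : ULift.{u} A × Fin 2 => (Yp (Dp ω.2 ω.1) ω.1, Dp ω.2 ω.1, ω.2)) ⁻¹'
          {(γ y, d, z)} = {a | Yp d a = γ y ∧ Dp z a = d} ×ˢ {z} := by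
        ext ⟨a, z'⟩
        simp only [Set.mem_preimage, Set.mem_singleton_iff, Prod.mk.injEq, Set.mem_prod,
          Set.mem_ofPred_eq]
        constructor
        · rintro ⟨h1, h2, rfl⟩
          exact ⟨⟨h2 ▸ h1, h2⟩, rfl⟩
        · rintro ⟨⟨h1, h2⟩, rfl⟩
          exact ⟨h2.symm ▸ h1, h2, rfl⟩
      rw [hpre, Measure.prod_prod, hνatom, hP.singleton_eq,
        Measure.map_apply hζm (measurableSet_singleton _)]
      rfl

/-! ### The characterization, irredundancy and the count -/

theorem ivCompatible_iff {n : ℕ} {γ : Fin n → ℝ} (hγ : StrictMono γ)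
    {P : Measure (ℝ × Fin 2 × Fin 2)} (hP : IsObservedLaw γ P) :
    IVCompatible.{u} γ P ↔ ∀ L ∈ ivForms n, L (condProb γ P) ≤ 0 := by
  have hp1 := hP.sum_condProb hγ
  simp only [ivForms_eq_image, Set.forall_mem_image, Set.mem_ofPred_eq, ivFacet_apply _ _ hp1,
    sub_nonpos]
  constructor
  · rintro ⟨Ω, _, μ, Ypot, Dpot, Y, D, Z, h, rfl⟩ ⟨d, S⟩ -
    exact h.sum_condProb_le_one hP hγ d _
  · intro h
    have hz : ∀ d z, ∑ k, condProb γ P k d z ≤ 1 := by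
      intro d z
      rw [← hp1 z]
      refine Finset.sum_le_sum fun k _ => ?_
      have h0 := condProb_nonneg γ P k 0 z
      have h1 := condProb_nonneg γ P k 1 z
      rcases Fin.exists_fin_two.1 ⟨d, rfl⟩ with rfl | rfl <;> linarith
    refine IVCompatible.of_sum_max_le_one hγ hP fun d => ?_
    classical
    -- This choice attains the maximum at every `k`; if it is constant, `hz` replaces the missing
    -- inequality.
    set S : Finset (Fin n) := {k | condProb γ P k d 1 ≤ condProb γ P k d 0} with hS
    have hSsum : ∑ k, max (condProb γ P k d 0) (condProb γ P k d 1) =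
        ∑ k, condProb γ P k d (if k ∈ S then 0 else 1) := by
      refine Finset.sum_congr rfl fun k _ => ?_
      by_cases hk : condProb γ P k d 1 ≤ condProb γ P k d 0
      · simp [hS, hk]
      · simp [hS, hk, (not_le.1 hk).le]
    rw [hSsum]
    rcases S.eq_empty_or_nonempty with h0 | h0
    · simpa [h0] using hz d 1
    by_cases h1 : S = Finset.univ
    · simpa [h1] using hz d 0
    · exact h (x := (d, S)) ⟨h0, h1⟩

theorem exists_observedLaw_violating_only {n : ℕ} {γ : Fin n → ℝ} (hγ : StrictMono γ) (d : Fin 2)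
    {S : Finset (Fin n)} (hS : S.Nonempty) (hS' : S ≠ Finset.univ) :
    ∃ P : Measure (ℝ × Fin 2 × Fin 2), IsObservedLaw γ P ∧ 0 < ivFacet d S (condProb γ P) ∧
      ∀ d' S', (d', S') ≠ (d, S) → ivFacet d' S' (condProb γ P) ≤ 0 := by
  obtain ⟨p, hp0, hp1, hpS, hp⟩ := exists_violating_only d hS hS'
  obtain ⟨P, hP, rfl⟩ := exists_observedLaw hγ hp0 hp1
  refine ⟨P, hP, ?_, fun d' S' hne => ?_⟩
  · rw [ivFacet_apply _ _ hp1]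
    linarith
  · rw [ivFacet_apply _ _ hp1]
    linarith [hp d' S' hne]

theorem ncard_ivForms {n : ℕ} {γ : Fin n → ℝ} (hn : 1 ≤ n) (hγ : StrictMono γ) :
    (ivForms n).ncard = 2 ^ (n + 1) - 4 := by
  rw [ivForms_eq_image, Set.InjOn.ncard_image]
  · have hset : {x : Fin 2 × Finset (Fin n) | x.2.Nonempty ∧ x.2 ≠ Finset.univ} =
        ((Finset.univ : Finset (Fin 2)) ×ˢ
          (Finset.univ \ {∅, Finset.univ} : Finset (Finset (Fin n))) : Finset _) := by
      ext ⟨d, S⟩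
      simp [Finset.nonempty_iff_ne_empty]
    have hne : (∅ : Finset (Fin n)) ≠ Finset.univ :=
      (Finset.ne_empty_of_mem (Finset.mem_univ (⟨0, hn⟩ : Fin n))).symm
    rw [hset, Set.ncard_coe_finset, Finset.card_product, Finset.card_sdiff_of_subset
      (Finset.subset_univ _), Finset.card_pair hne]
    simp only [Finset.card_univ, Fintype.card_fin, Fintype.card_finset]
    rw [pow_succ]
    omega
  -- Distinct labels give distinct forms: a law violating only the first would otherwise make the
  -- same form both positive and nonpositive.
  · rintro ⟨d, S⟩ ⟨hS, hS'⟩ ⟨d', S'⟩ - heq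
    by_contra hne
    obtain ⟨P, -, hpos, hle⟩ := exists_observedLaw_violating_only hγ d hS hS'
    have := hle d' S' (Ne.symm hne)
    simp only at heq
    rw [← heq] at this
    linarith

theorem mainTheorem5 (n : ℕ) (hn : 1 ≤ n) (γ : Fin n → ℝ) (hγ : StrictMono γ) :
    (∀ P : Measure (ℝ × Fin 2 × Fin 2), IsObservedLaw γ P →
      (IVCompatible.{u} γ P ↔ ∀ L ∈ ivForms n, L (condProb γ P) ≤ 0)) ∧
    (∀ L ∈ ivForms n, ∃ P : Measure (ℝ × Fin 2 × Fin 2), IsObservedLaw γ P ∧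
      0 < L (condProb γ P) ∧ ∀ L' ∈ ivForms n, L' ≠ L → L' (condProb γ P) ≤ 0) ∧
    (ivForms n).ncard = 2 ^ (n + 1) - 4 := by
  refine ⟨fun P hP => ivCompatible_iff hγ hP, ?_, ncard_ivForms hn hγ⟩
  rw [ivForms_eq_image]
  rintro _ ⟨⟨d, S⟩, ⟨hS, hS'⟩, rfl⟩
  obtain ⟨P, hP, hpos, hle⟩ := exists_observedLaw_violating_only hγ d hS hS'
  refine ⟨P, hP, hpos, ?_⟩
  rintro _ ⟨⟨d', S'⟩, -, rfl⟩ hne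
  exact hle d' S' fun h => hne (by rw [h])
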